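/- Let $n\ge 2$, let $1\le d_1<\dots<d_n$ be integers, let $a_1,\dots,a_n$ be non-zero reals, and put $\gamma_i(t)=a_it^{d_i}$. For $k\in\mathbb Z$ let $$B_k(g_1,\dots,g_n)(x)=\int_0^1\prod_{i=1}^n g_i\big(x-\gamma_i(2^{-k}t)\big)\,dt,\qquad \psi_k(x)=2^k\psi(2^kx).$$ Let $p_1,\dots,p_n\in(1,\infty]$ and $p\in[1,\infty]$ satisfy $\frac1p=\sum_{i=1}^n\frac1{p_i}\le 1$. Then there is $N\in\mathbb N$ such that for every $A$ there is a finite constant $C$, depending only on $A$, $n$, the $a_i$, $d_i$ and $p_i$, with the following property. For every Schwartz function $\psi:\mathbb R\to\mathbb C$ with $\sup_x|x|^j|\psi^{(l)}(x)|\le A$ for all $0\le j,l\le N$ (in particular for every such $\psi$ whose Fourier transform is a Littlewood–Paley bump adapted to $|\xi|\approx1$), all $s_1,\dots,s_n\in\mathbb Z$ with $s:=\max_i s_i$, and all $f_i\in L^{p_i}(\mathbb R)$, $1\le i\le n$, $$\Big\|\sup_{k\in\mathbb Z}\big|B_k(\psi_{kd_1+s_1}*f_1,\dots,\psi_{kd_n+s_n}*f_n)\big|\Big\|_{L^p(\mathbb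 R)}\le C\,\max(1,s)^n\prod_{i=1}^n\|f_i\|_{L^{p_i}(\mathbb R)}.$$ In particular the bound is $C s^n\prod_i\|f_i\|_{L^{p_i}(\mathbb R)}$ whenever $s\ge1$. -/

import Mathlib

open MeasureTheory
open scoped ENNReal NNReal SchwartzMap Convolution

namespace HomCurve

noncomputable section

/-- The `L¹`-normalized dyadic dilation `φ_k(x) = 2^k φ(2^k x)`, `k ∈ ℤ`. -/
def dilate (φ : ℝ → ℂ) (k : ℤ) : ℝ → ℂ :=
  fun x => ((2 : ℝ) ^ k) • φ ((2 : ℝ) ^ k * x)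

/-- The homogeneous polynomial curve `γ_i(t) = a_i t^{d_i}`. -/
def curve {n : ℕ} (a : Fin n → ℝ) (d : Fin n → ℕ) : Fin n → ℝ → ℝ :=
  fun i t => a i * t ^ d i

/-- `B_k(f_1,…,f_n)(x) = ∫_0^1 ∏_i f_i(x - γ_i(2^{-k} t)) dt`. -/
def multiAvg {n : ℕ} (γ : Fin n → ℝ → ℝ) (k : ℤ) (f : Fin n → ℝ → ℂ) : ℝ → ℂ :=
  fun x => ∫ t in (0 : ℝ)..1, ∏ i, f i (x - γ i ((2 : ℝ) ^ (-k) * t))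

/-- The frequency-localized function `ψ_j * f` (convolution over `ℝ`). -/
def localize (ψ : ℝ → ℂ) (j : ℤ) (f : ℝ → ℂ) : ℝ → ℂ :=
  (dilate ψ j) ⋆[ContinuousLinearMap.mul ℂ ℂ, volume] f

/-- The shifted maximal function
`sup_{k ∈ ℤ} |B_k(ψ_{k d_1 + s_1} * f_1, …, ψ_{k d_n + s_n} * f_n)(x)|`, with values in `[0,∞]`. -/
def shiftedMax {n : ℕ} (a : Fin n → ℝ) (d : Fin n → ℕ) (ψ : ℝ → ℂ) (s : Fin n → ℤ)
    (f : Fin n → ℝ → ℂ) : ℝ → ℝ≥0∞ :=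
  fun x => ⨆ k : ℤ,
    ‖multiAvg (curve a d) k (fun i => localize ψ (k * (d i : ℤ) + s i) (f i)) x‖ₑ

end

end HomCurve

namespace HomCurve

noncomputable section

/-! No cancellation is needed: pointwise domination suffices. By the decay of `ψ`, each localization
of `f_i` at scale `r = 2^{-(k d_i + s_i)}` is bounded by averages of `|f_i|` over intervals of
radius `2^l r`. Moving the supremum over `k` inside the `t`-integral bounds the maximal function by
`∫_0^1` of a product over `i` of maximal functions whose intervals are shifted by `γ_i(2^{-k} t)`
(`shiftedMax_le_lintegral`).

For fixed `t` the shift is at most about `2^{max(1,s)}` times the radius `r`, and such a maximal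
function has `L^q` norm growing only logarithmically in this ratio, hence linearly in `max(1,s)`
(`exists_eLpNorm_shiftedSup_le`). The reason is a Vitali covering in which only `O(max(1,s))` scales
per selected interval carry a shift too long to be absorbed by enlargement. Hölder in `x`, with one
such factor for each `i`, and Jensen in `t` give the power `n`. -/

/-! ### Shifted maximal functions -/

/-- The average of `h` over the interval `[y - ρ, y + ρ]`. -/
def ballAvg (h : ℝ → ℝ≥0∞) (ρ y : ℝ) : ℝ≥0∞ :=
  (∫⁻ z in Metric.closedBall y ρ, h z) / ENNReal.ofReal (2 * ρ)

/-- The maximal function over the intervals centred at `x - b k` of radius `2 ^ l * r k`. -/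
def shiftedSup (b r : ℤ → ℝ) (h : ℝ → ℝ≥0∞) (x : ℝ) : ℝ≥0∞ :=
  ⨆ k : ℤ, ⨆ l : ℕ, ballAvg h (2 ^ l * r k) (x - b k)

lemma measurable_ballAvg {h : ℝ → ℝ≥0∞} (hh : Measurable h) (ρ : ℝ) :
    Measurable (ballAvg h ρ) := by
  have h1 : Measurable fun y : ℝ => ∫⁻ z in Metric.closedBall y ρ, h z := by
    have : (fun y : ℝ => ∫⁻ z in Metric.closedBall y ρ, h z) = fun y : ℝ =>
        ∫⁻ z, {w : ℝ × ℝ | dist w.2 w.1 ≤ ρ}.indicator (fun w => h w.2) (y, z) := by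
      funext y
      rw [← lintegral_indicator Metric.isClosed_closedBall.measurableSet]
      rfl
    rw [this]
    refine Measurable.lintegral_prod_right' (ν := volume) (Measurable.indicator ?_ ?_)
    · exact hh.comp measurable_snd
    · exact measurableSet_le (measurable_snd.dist measurable_fst) measurable_const
  exact h1.div_const _

lemma measurable_shiftedSup {h : ℝ → ℝ≥0∞} (hh : Measurable h) (b r : ℤ → ℝ) :
    Measurable (shiftedSup b r h) :=
  Measurable.iSup fun k => Measurable.iSup fun _ =>
    (measurable_ballAvg hh _).comp (measurable_id.sub_const (b k))

lemma ballAvg_le_of_ae_le {h : ℝ → ℝ≥0∞} {M : ℝ≥0∞} (hM : ∀ᵐ x, h x ≤ M) (ρ : ℝ)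
    (y : ℝ) : ballAvg h ρ y ≤ M := by
  refine ENNReal.div_le_of_le_mul ?_
  calc ∫⁻ z in Metric.closedBall y ρ, h z ≤ ∫⁻ _ in Metric.closedBall y ρ, M :=
        lintegral_mono_ae (ae_restrict_of_ae hM)
    _ = M * ENNReal.ofReal (2 * ρ) := by simp [Real.volume_closedBall]

lemma shiftedSup_le_of_ae_le {h : ℝ → ℝ≥0∞} {M : ℝ≥0∞} (hM : ∀ᵐ x, h x ≤ M) (b r : ℤ → ℝ)
    (x : ℝ) : shiftedSup b r h x ≤ M :=
  iSup_le fun _ => iSup_le fun _ => ballAvg_le_of_ae_le hM _ _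

lemma ballAvg_add {h g : ℝ → ℝ≥0∞} (hh : Measurable h) (ρ y : ℝ) :
    ballAvg (h + g) ρ y = ballAvg h ρ y + ballAvg g ρ y := by
  simp only [ballAvg, Pi.add_apply]
  rw [lintegral_add_left hh, ENNReal.add_div]

lemma shiftedSup_add_le {h g : ℝ → ℝ≥0∞} (hh : Measurable h) (b r : ℤ → ℝ) (x : ℝ) :
    shiftedSup b r (h + g) x ≤ shiftedSup b r h x + shiftedSup b r g x := by
  refine iSup_le fun k => iSup_le fun l => ?_
  rw [ballAvg_add hh]
  exact add_le_add (le_iSup₂_of_le k l le_rfl) (le_iSup₂_of_le k l le_rfl)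

/-! ### Counting long shifts, and the weak-type bound -/

/-- `L` bounds the number of scales `r k ≲ R` whose shift exceeds `R`. -/
def ShiftCountLE (b r : ℤ → ℝ) (L : ℕ) : Prop :=
  ∀ R > 0, ∃ K : Finset ℤ, K.card ≤ L ∧ ∀ k, r k ≤ 5 * R → R < |b k| → k ∈ K

/-- A long shift at a scale `≲ R` traps the radius between about `2^{-e} R` and `5R`, a window
containing `O(e)` powers of two; distinct `k` give distinct radii since `d ≥ 1`. -/
lemma shiftCountLE_of_dyadic {b : ℤ → ℝ} {d : ℕ} (hd : 1 ≤ d) (s : ℤ) (e : ℕ)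
    (hb : ∀ k, |b k| ≤ 2 ^ e * (2 : ℝ) ^ (-(k * d + s))) :
    ShiftCountLE b (fun k => (2 : ℝ) ^ (-(k * d + s))) (e + 4) := by
  intro R hR
  obtain ⟨j, hj1, hj2⟩ := exists_mem_Ico_zpow hR (one_lt_two : (1 : ℝ) < 2)
  have hinj : Function.Injective fun k : ℤ => -(k * d + s) := by
    intro k k' h
    have : d ≠ 0 := by omega
    simpa [this] using h
  refine ⟨(Finset.Ioc (j - e) (j + 4)).preimage _ hinj.injOn, ?_, ?_⟩
  · refine (Finset.card_le_card_of_injOn (t := Finset.Ioc (j - e) (j + 4)) _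
      (fun k hk => Finset.mem_preimage.1 hk) hinj.injOn).trans ?_
    rw [Int.card_Ioc]
    omega
  · intro k hk1 hk2
    simp only [Finset.mem_preimage, Finset.mem_Ioc]
    have h2 : (1 : ℝ) < 2 := one_lt_two
    constructor
    · have h3 : (2 : ℝ) ^ j < 2 ^ ((e : ℤ) + -(k * d + s)) := by
        rw [zpow_add₀ two_ne_zero, zpow_natCast]
        exact hj1.trans_lt (hk2.trans_le (hb k))
      have := (zpow_lt_zpow_iff_right₀ h2).1 h3
      omega
    -- The factor 5, which is the Vitali enlargement, is rounded up to `2^3`.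
    · have h3 : (2 : ℝ) ^ (-(k * d + s)) < 2 ^ (3 + (j + 1)) := by
        rw [zpow_add₀ two_ne_zero]
        refine hk1.trans_lt ?_
        norm_num
        nlinarith
      have := (zpow_lt_zpow_iff_right₀ h2).1 h3
      omega

/-- The weak-type `(1, 1)` bound for the shifted maximal function. -/
theorem mul_volume_lt_shiftedSup_le {b r : ℤ → ℝ} (hr : ∀ k, 0 < r k) {L : ℕ}
    (hL : ShiftCountLE b r L) (h : ℝ → ℝ≥0∞) {lam : ℝ} (hlam : 0 < lam) :
    ENNReal.ofReal lam * volume {x | ENNReal.ofReal lam < shiftedSup b r h x}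
      ≤ (6 + 5 * L : ℕ) * ∫⁻ x, h x := by
  -- Finiteness of the integral bounds the radii in `hbd`, as the Vitali lemma requires.
  rcases eq_or_ne (∫⁻ x, h x) ∞ with htop | hfin
  · rw [htop, ENNReal.mul_top (by simp)]
    exact le_top
  -- An index `(k, l, x)` records the point `x` as well as the interval, whose centre may be far
  -- from `x`.
  let c : ℤ × ℕ × ℝ → ℝ := fun i => i.2.2 - b i.1
  let ρ : ℤ × ℕ × ℝ → ℝ := fun i => 2 ^ i.2.1 * r i.1
  have hρ : ∀ i, 0 < ρ i := fun i => by have := hr i.1; positivity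
  let T : Set (ℤ × ℕ × ℝ) := {i | ENNReal.ofReal lam < ballAvg h (ρ i) (c i)}
  have hT : ∀ i ∈ T, ENNReal.ofReal (lam * (2 * ρ i)) ≤ ∫⁻ z in Metric.closedBall (c i) (ρ i), h z := by
    intro i hi
    have h0 : ENNReal.ofReal (2 * ρ i) ≠ 0 := by simp [hρ i]
    rw [ENNReal.ofReal_mul hlam.le]
    exact ((ENNReal.lt_div_iff_mul_lt (Or.inl h0) (Or.inl ENNReal.ofReal_ne_top)).1 hi).le
  have hbd : ∀ i ∈ T, ρ i ≤ (∫⁻ x, h x).toReal / lam := by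
    intro i hi
    have h1 := (hT i hi).trans (setLIntegral_le_lintegral _ _)
    have h2 := (ENNReal.ofReal_le_iff_le_toReal hfin).1 h1
    rw [le_div_iff₀ hlam]
    nlinarith [hρ i, mul_pos hlam (hρ i)]
  obtain ⟨u, huT, hdisj, hcov⟩ := Vitali.exists_disjoint_subfamily_covering_enlargement_closedBall
    T c ρ _ hbd 5 (by norm_num)
  have hucount : u.Countable := hdisj.countable_of_nonempty_interior fun i _ =>
    ⟨c i, Metric.ball_subset_interior_closedBall (Metric.mem_ball_self (hρ i))⟩
  choose K hKcard hK using fun i => hL (ρ i) (hρ i)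
  have hsub : {x | ENNReal.ofReal lam < shiftedSup b r h x} ⊆
      ⋃ i ∈ u, (Metric.closedBall (c i) (6 * ρ i) ∪
        ⋃ k ∈ K i, Metric.closedBall (c i + b k) (5 * ρ i)) := by
    intro x hx
    simp only [Set.mem_ofPred_eq, shiftedSup, lt_iSup_iff] at hx
    obtain ⟨k, l, hkl⟩ := hx
    obtain ⟨i, hi, hsubi⟩ := hcov (k, l, x) hkl
    have hc : c (k, l, x) = x - b k := rfl
    have hr' : ρ (k, l, x) = 2 ^ l * r k := rfl
    rw [Real.closedBall_eq_Icc, Real.closedBall_eq_Icc,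
      Set.Icc_subset_Icc_iff (by linarith [hρ (k, l, x)]), hc, hr'] at hsubi
    obtain ⟨h1, h2⟩ := hsubi
    have hl : r k ≤ 2 ^ l * r k := le_mul_of_one_le_left (hr k).le (one_le_pow₀ one_le_two)
    have hrk := hr k
    refine Set.mem_iUnion₂.2 ⟨i, hi, ?_⟩
    -- The point `x` is within `5 ρ i` of `c i + b k`. A short shift is absorbed by enlarging 5 to
    -- 6; a long one leaves at most `L` possible values of `k`.
    by_cases hbk : ρ i < |b k|
    · refine Or.inr (Set.mem_iUnion₂.2 ⟨k, hK i k (by linarith) hbk, ?_⟩)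
      rw [Real.closedBall_eq_Icc]
      constructor <;> linarith
    · refine Or.inl ?_
      have := abs_le.1 (not_lt.1 hbk)
      rw [Real.closedBall_eq_Icc]
      constructor <;> linarith [this.1, this.2]
  have hvol : ∀ i ∈ u, ENNReal.ofReal lam * volume (Metric.closedBall (c i) (6 * ρ i) ∪
        ⋃ k ∈ K i, Metric.closedBall (c i + b k) (5 * ρ i)) ≤
      (6 + 5 * L : ℕ) * ∫⁻ z in Metric.closedBall (c i) (ρ i), h z := by
    intro i hi
    have h1 : volume (Metric.closedBall (c i) (6 * ρ i) ∪
        ⋃ k ∈ K i, Metric.closedBall (c i + b k) (5 * ρ i)) ≤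
        (6 + 5 * L : ℕ) * ENNReal.ofReal (2 * ρ i) := by
      refine (measure_union_le _ _).trans ?_
      have h2 : volume (⋃ k ∈ K i, Metric.closedBall (c i + b k) (5 * ρ i)) ≤
          (L : ℝ≥0∞) * ENNReal.ofReal (2 * (5 * ρ i)) := by
        refine (measure_biUnion_finset_le _ _).trans ?_
        simp only [Real.volume_closedBall, Finset.sum_const, nsmul_eq_mul]
        gcongr
        exact hKcard i
      refine (add_le_add le_rfl h2).trans (le_of_eq ?_)
      rw [Real.volume_closedBall, ← ENNReal.ofReal_natCast L, ← ENNReal.ofReal_natCast (6 + 5 * L),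
        ← ENNReal.ofReal_mul (by positivity), ← ENNReal.ofReal_mul (by positivity),
        ← ENNReal.ofReal_add (by linarith [hρ i]) (by have := hρ i; positivity)]
      push_cast
      ring_nf
    calc _ ≤ ENNReal.ofReal lam * ((6 + 5 * L : ℕ) * ENNReal.ofReal (2 * ρ i)) := by gcongr
      _ = (6 + 5 * L : ℕ) * ENNReal.ofReal (lam * (2 * ρ i)) := by
          rw [ENNReal.ofReal_mul hlam.le]; ring
      _ ≤ _ := by gcongr; exact hT i (huT hi)
  have : Countable u := hucount
  calc _ ≤ ENNReal.ofReal lam * ∑' i : u, volume (Metric.closedBall (c i) (6 * ρ i) ∪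
        ⋃ k ∈ K i, Metric.closedBall (c i + b k) (5 * ρ i)) := by
        gcongr
        exact (measure_mono hsub).trans (measure_biUnion_le _ hucount _)
    _ = ∑' i : u, ENNReal.ofReal lam * volume (Metric.closedBall (c i) (6 * ρ i) ∪
        ⋃ k ∈ K i, Metric.closedBall (c i + b k) (5 * ρ i)) := ENNReal.tsum_mul_left.symm
    _ ≤ ∑' i : u, (6 + 5 * L : ℕ) * ∫⁻ z in Metric.closedBall (c i) (ρ i), h z :=
        ENNReal.tsum_le_tsum fun i => hvol i i.2
    _ = (6 + 5 * L : ℕ) * ∫⁻ z in ⋃ i ∈ u, Metric.closedBall (c i) (ρ i), h z := by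
        rw [ENNReal.tsum_mul_left, lintegral_biUnion hucount
          (fun _ _ => Metric.isClosed_closedBall.measurableSet) hdisj]
    _ ≤ _ := mul_le_mul_right (setLIntegral_le_lintegral _ _) _

/-! ### From weak type to strong type -/

/-- The layer-cake formula for a power of an extended non-negative real. -/
lemma lintegral_Ioi_indicator_rpow (g : ℝ≥0∞) {p : ℝ} (hp : 0 < p) :
    ∫⁻ t in Set.Ioi (0 : ℝ), {t : ℝ | ENNReal.ofReal t < g}.indicator
      (fun t => ENNReal.ofReal (p * t ^ (p - 1))) t = g ^ p := by
  have key : ∀ a : ℝ, 0 ≤ a → ∫⁻ t in Set.Ioi (0 : ℝ),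
      {t : ℝ | ENNReal.ofReal t < ENNReal.ofReal a}.indicator
      (fun t => ENNReal.ofReal (p * t ^ (p - 1))) t = ENNReal.ofReal a ^ p := by
    intro a ha
    have hset : MeasurableSet {t : ℝ | ENNReal.ofReal t < ENNReal.ofReal a} :=
      measurableSet_lt ENNReal.measurable_ofReal measurable_const
    rw [lintegral_indicator hset, Measure.restrict_restrict hset]
    have hS : {t : ℝ | ENNReal.ofReal t < ENNReal.ofReal a} ∩ Set.Ioi 0 = Set.Ioo 0 a := by
      ext t
      simp only [Set.mem_inter_iff, Set.mem_ofPred_eq, Set.mem_Ioi, Set.mem_Ioo]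
      constructor
      · rintro ⟨h1, h2⟩
        exact ⟨h2, (ENNReal.ofReal_lt_ofReal_iff_of_nonneg h2.le).1 h1⟩
      · rintro ⟨h1, h2⟩
        exact ⟨(ENNReal.ofReal_lt_ofReal_iff_of_nonneg h1.le).2 h2, h1⟩
    have hint : IntervalIntegrable (fun t : ℝ => p * t ^ (p - 1)) volume 0 a :=
      (intervalIntegral.intervalIntegrable_rpow' (by linarith)).const_mul p
    rw [hS, restrict_Ioo_eq_restrict_Ioc, ← ofReal_integral_eq_lintegral_ofReal,
      ← intervalIntegral.integral_of_le ha, intervalIntegral.integral_const_mul,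
      integral_rpow (Or.inl (by linarith)), ENNReal.ofReal_rpow_of_nonneg ha hp.le]
    · congr 1
      rw [sub_add_cancel, Real.zero_rpow hp.ne', sub_zero]
      field_simp
    · exact (intervalIntegrable_iff_integrableOn_Ioc_of_le ha).1 hint
    · refine (ae_restrict_iff' measurableSet_Ioc).2 (Filter.Eventually.of_forall fun t ht => ?_)
      have := ht.1
      simp only [Pi.zero_apply]
      positivity
  rcases eq_or_ne g ∞ with rfl | hg
  · rw [ENNReal.top_rpow_of_pos hp]
    refine ENNReal.eq_top_of_forall_nnreal_le fun c => ?_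
    -- Truncating at `c^{1/p}` makes the integral exceed any prescribed `c`.
    have h1 := key ((c : ℝ) ^ p⁻¹) (by positivity)
    rw [ENNReal.ofReal_rpow_of_nonneg (by positivity) hp.le, ← Real.rpow_mul c.coe_nonneg,
      inv_mul_cancel₀ hp.ne', Real.rpow_one, ENNReal.ofReal_coe_nnreal] at h1
    rw [← h1]
    refine lintegral_mono fun t => ?_
    exact Set.indicator_le_indicator_of_subset
      (fun t (ht : _ < _) => ht.trans ENNReal.ofReal_lt_top) (fun _ => zero_le) t
  · rw [← ENNReal.ofReal_toReal hg]
    exact key _ ENNReal.toReal_nonneg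

/-- Marcinkiewicz truncation: the part of `h` below `t/2` contributes at most `t/2` to the maximal
function, so the weak-type bound at height `t/2` is needed only for the rest. -/
lemma mul_volume_lt_shiftedSup_le_truncation {b r : ℤ → ℝ} (hr : ∀ k, 0 < r k) {L : ℕ}
    (hL : ShiftCountLE b r L) {h : ℝ → ℝ≥0∞} (hh : Measurable h) {t : ℝ} (ht : 0 < t) :
    ENNReal.ofReal t * volume {x | ENNReal.ofReal t < shiftedSup b r h x}
      ≤ 2 * (6 + 5 * L : ℕ) *
        ∫⁻ x, {x | ENNReal.ofReal t < 2 * h x}.indicator h x := by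
  set S : Set ℝ := {x | ENNReal.ofReal t < 2 * h x} with hS
  have hSm : MeasurableSet S := measurableSet_lt measurable_const (hh.const_mul 2)
  have h2 : ENNReal.ofReal t = 2 * ENNReal.ofReal (t / 2) := by
    rw [← ENNReal.ofReal_ofNat 2, ← ENNReal.ofReal_mul (by norm_num)]
    congr 1
    ring
  have hsplit : S.indicator h + Sᶜ.indicator h = h := Set.indicator_self_add_compl S h
  have hsmall : ∀ x, Sᶜ.indicator h x ≤ ENNReal.ofReal (t / 2) := by
    intro x
    by_cases hx : x ∈ S
    · simp [hx]
    · rw [Set.indicator_of_mem (Set.mem_compl hx)]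
      have hx' : 2 * h x ≤ ENNReal.ofReal t := not_lt.1 hx
      rw [h2] at hx'
      exact (ENNReal.mul_le_mul_iff_right (by norm_num) (by norm_num)).1 hx'
  have hsub : {x | ENNReal.ofReal t < shiftedSup b r h x} ⊆
      {x | ENNReal.ofReal (t / 2) < shiftedSup b r (S.indicator h) x} := by
    intro x hx
    by_contra hcon
    have hcon' : shiftedSup b r (S.indicator h) x ≤ ENNReal.ofReal (t / 2) := not_lt.1 hcon
    have h3 := shiftedSup_add_le (g := Sᶜ.indicator h) (hh.indicator hSm) b r x
    rw [hsplit] at h3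
    have h4 := shiftedSup_le_of_ae_le (Filter.Eventually.of_forall hsmall) b r x
    have h5 := h3.trans (add_le_add hcon' h4)
    rw [← two_mul, ← h2] at h5
    exact absurd hx (not_lt.2 h5)
  calc _ ≤ 2 * ENNReal.ofReal (t / 2) *
        volume {x | ENNReal.ofReal (t / 2) < shiftedSup b r (S.indicator h) x} := by
        rw [← h2]
        gcongr
    _ = 2 * (ENNReal.ofReal (t / 2) *
        volume {x | ENNReal.ofReal (t / 2) < shiftedSup b r (S.indicator h) x}) := mul_assoc _ _ _
    _ ≤ 2 * ((6 + 5 * L : ℕ) * ∫⁻ x, S.indicator h x) := by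
        exact mul_le_mul_right (mul_volume_lt_shiftedSup_le hr hL _ (by positivity)) _
    _ = _ := (mul_assoc _ _ _).symm

lemma measurable_indicator_ofReal_lt {g : ℝ → ℝ≥0∞} (hg : Measurable g) {u : ℝ → ℝ≥0∞}
    (hu : Measurable u) : Measurable fun z : ℝ × ℝ =>
      {t : ℝ | ENNReal.ofReal t < g z.1}.indicator u z.2 := by
  have : (fun z : ℝ × ℝ => {t : ℝ | ENNReal.ofReal t < g z.1}.indicator u z.2) =
      {z : ℝ × ℝ | ENNReal.ofReal z.2 < g z.1}.indicator fun z => u z.2 := rfl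
  rw [this]
  exact (hu.comp measurable_snd).indicator
    (measurableSet_lt (ENNReal.measurable_ofReal.comp measurable_snd) (hg.comp measurable_fst))

lemma lintegral_rpow_eq_lintegral_Ioi_meas_lt {g : ℝ → ℝ≥0∞} (hg : Measurable g) {p : ℝ}
    (hp : 0 < p) : ∫⁻ x, g x ^ p = ∫⁻ t in Set.Ioi (0 : ℝ),
      ENNReal.ofReal (p * t ^ (p - 1)) * volume {x | ENNReal.ofReal t < g x} := by
  simp_rw [← lintegral_Ioi_indicator_rpow _ hp]
  rw [lintegral_lintegral_swap]
  · refine lintegral_congr fun t => ?_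
    rw [← lintegral_indicator_const (measurableSet_lt measurable_const hg)]
    rfl
  · exact (measurable_indicator_ofReal_lt hg
      (u := fun t => ENNReal.ofReal (p * t ^ (p - 1))) (by fun_prop)).aemeasurable

/-- The strong-type bound for the shifted maximal function. -/
theorem lintegral_shiftedSup_rpow_le {b r : ℤ → ℝ} (hr : ∀ k, 0 < r k) {L : ℕ}
    (hL : ShiftCountLE b r L) {h : ℝ → ℝ≥0∞} (hh : Measurable h) {q : ℝ} (hq : 1 < q) :
    ∫⁻ x, shiftedSup b r h x ^ q ≤
      2 * ENNReal.ofReal (q / (q - 1)) * 2 ^ (q - 1) * (6 + 5 * L : ℕ) * ∫⁻ x, h x ^ q := by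
  have hq0 : 0 < q := by linarith
  have hq1 : 0 < q - 1 := by linarith
  rw [lintegral_rpow_eq_lintegral_Ioi_meas_lt (measurable_shiftedSup hh b r) hq0]
  -- The layer-cake weight `q t^{q-1}` is `q/(q-1) · u t · t`. The factor `t` is spent on the
  -- weak-type bound, and integrating `u` up to `2h` leaves `(2h)^{q-1}`.
  set u : ℝ → ℝ≥0∞ := fun t => ENNReal.ofReal ((q - 1) * t ^ (q - 1 - 1)) with hu
  have hum : Measurable u := by fun_prop
  set W : ℝ≥0∞ := 2 * (6 + 5 * L : ℕ) * ENNReal.ofReal (q / (q - 1)) with hW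
  calc _ ≤ ∫⁻ t in Set.Ioi (0 : ℝ),
        ∫⁻ x, W * (h x * {t : ℝ | ENNReal.ofReal t < 2 * h x}.indicator u t) := by
        refine setLIntegral_mono' measurableSet_Ioi fun t (ht : 0 < t) => ?_
        have h1 : ENNReal.ofReal (q * t ^ (q - 1)) =
            ENNReal.ofReal (q / (q - 1)) * u t * ENNReal.ofReal t := by
          rw [hu, ← ENNReal.ofReal_mul (by positivity), ← ENNReal.ofReal_mul (by positivity)]
          congr 1
          rw [Real.rpow_sub_one ht.ne' (q - 1)]
          field_simp
        rw [h1, mul_assoc]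
        refine (mul_le_mul_right (mul_volume_lt_shiftedSup_le_truncation hr hL hh ht) _).trans
          (le_of_eq ?_)
        have h2 : ∀ x, W * (h x * {t : ℝ | ENNReal.ofReal t < 2 * h x}.indicator u t) =
            W * u t * {x | ENNReal.ofReal t < 2 * h x}.indicator h x := by
          intro x
          by_cases hx : ENNReal.ofReal t < 2 * h x
          · rw [Set.indicator_of_mem (s := {t : ℝ | ENNReal.ofReal t < 2 * h x}) hx,
              Set.indicator_of_mem (s := {x | ENNReal.ofReal t < 2 * h x}) hx]
            ring
          · rw [Set.indicator_of_notMem (s := {t : ℝ | ENNReal.ofReal t < 2 * h x}) hx,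
              Set.indicator_of_notMem (s := {x | ENNReal.ofReal t < 2 * h x}) hx]
            simp
        simp_rw [h2]
        rw [lintegral_const_mul _ (hh.indicator (measurableSet_lt measurable_const
          (hh.const_mul 2))), hW]
        ring
    _ = ∫⁻ x, ∫⁻ t in Set.Ioi (0 : ℝ),
          W * (h x * {t : ℝ | ENNReal.ofReal t < 2 * h x}.indicator u t) := by
        refine (lintegral_lintegral_swap ?_).symm
        exact (((hh.comp measurable_fst).mul
          (measurable_indicator_ofReal_lt (hh.const_mul 2) hum)).const_mul W).aemeasurable
    _ = ∫⁻ x, W * 2 ^ (q - 1) * h x ^ q := by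
        refine lintegral_congr fun x => ?_
        have hm : Measurable ({t : ℝ | ENNReal.ofReal t < 2 * h x}.indicator u) :=
          hum.indicator (measurableSet_lt ENNReal.measurable_ofReal measurable_const)
        rw [lintegral_const_mul _ (hm.const_mul _), lintegral_const_mul _ hm,
          lintegral_Ioi_indicator_rpow _ hq1, ENNReal.mul_rpow_of_nonneg _ _ hq1.le]
        have : h x ^ q = h x * h x ^ (q - 1) := by
          conv_lhs => rw [show q = 1 + (q - 1) by ring]
          rw [ENNReal.rpow_add_of_nonneg _ _ zero_le_one hq1.le, ENNReal.rpow_one]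
        rw [this]
        ring
    _ = _ := by
        rw [lintegral_const_mul _ (hh.pow_const q), hW]
        ring

/-- The shifted maximal function is bounded on `L^q` for `1 < q ≤ ∞`, with a constant growing at
most linearly in the number of long shifts. -/
theorem exists_eLpNorm_shiftedSup_le {q : ℝ≥0∞} (hq : 1 < q) :
    ∃ C : ℝ≥0, 1 ≤ C ∧ ∀ (b r : ℤ → ℝ) (L : ℕ), (∀ k, 0 < r k) → ShiftCountLE b r L →
      ∀ h : ℝ → ℝ≥0∞, Measurable h →
        eLpNorm (shiftedSup b r h) q volume ≤ C * (6 + 5 * L : ℕ) * eLpNorm h q volume := by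
  rcases eq_or_ne q ∞ with rfl | hqt
  · refine ⟨1, le_rfl, fun b r L hr hL h hh => ?_⟩
    rw [eLpNorm_exponent_top, eLpNorm_exponent_top]
    have hb : ∀ x, ‖shiftedSup b r h x‖ₑ ≤ eLpNormEssSup h volume := fun x =>
      shiftedSup_le_of_ae_le (enorm_ae_le_eLpNormEssSup h volume) b r x
    refine (eLpNormEssSup_le_of_ae_enorm_bound (Filter.Eventually.of_forall hb)).trans ?_
    refine le_mul_of_one_le_left (zero_le) ?_
    rw [ENNReal.coe_one, one_mul]
    exact_mod_cast (by omega : 1 ≤ 6 + 5 * L)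
  · have hq1 : 1 < q.toReal := by
      rw [← ENNReal.toReal_one]
      exact (ENNReal.toReal_lt_toReal ENNReal.one_ne_top hqt).2 hq
    have hq0 : 0 < q.toReal := by linarith
    set K : ℝ≥0∞ := 2 * ENNReal.ofReal (q.toReal / (q.toReal - 1)) * 2 ^ (q.toReal - 1) with hK
    have hKt : K + 1 ≠ ∞ := by
      have : (2 : ℝ≥0∞) ^ (q.toReal - 1) ≠ ∞ :=
        ENNReal.rpow_ne_top_of_nonneg (by linarith) (by norm_num)
      finiteness
    -- Adding 1 makes the constant at least 1, so its `1/q`-th power can be bounded by the constant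
    -- itself.
    refine ⟨(K + 1).toNNReal, ?_, fun b r L hr hL h hh => ?_⟩
    · rw [← ENNReal.coe_le_coe, ENNReal.coe_toNNReal hKt]
      exact le_add_self
    rw [ENNReal.coe_toNNReal hKt, eLpNorm_eq_lintegral_rpow_enorm_toReal (by positivity) hqt,
      eLpNorm_eq_lintegral_rpow_enorm_toReal (by positivity) hqt]
    simp only [enorm_eq_self]
    set W : ℝ≥0∞ := ((6 + 5 * L : ℕ) : ℝ≥0∞) with hW
    have hW1 : 1 ≤ (K + 1) * W := one_le_mul le_add_self (by
      rw [hW]; exact_mod_cast (by omega : 1 ≤ 6 + 5 * L))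
    calc _ ≤ ((K + 1) * W * ∫⁻ x, h x ^ q.toReal) ^ (1 / q.toReal) := by
          refine ENNReal.rpow_le_rpow ?_ (by positivity)
          refine (lintegral_shiftedSup_rpow_le hr hL hh hq1).trans ?_
          rw [← hK]
          gcongr
          exact le_self_add
      _ = ((K + 1) * W) ^ (1 / q.toReal) * (∫⁻ x, h x ^ q.toReal) ^ (1 / q.toReal) :=
          ENNReal.mul_rpow_of_nonneg _ _ (by positivity)
      _ ≤ _ := by
          gcongr
          refine (ENNReal.rpow_le_rpow_of_exponent_le hW1 ?_).trans (ENNReal.rpow_one _).le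
          rw [div_le_one hq0]
          exact hq1.le

/-! ### Domination of localizations by averages -/

/-- At each point a single term suffices: the least `l` with `|2^j u| ≤ 2^l` has `4^l ≤ 4 (1 + |2^j
u|)^2`, so quadratic decay controls the kernel there. -/
lemma enorm_dilate_le_tsum {φ : ℝ → ℂ} {D : ℝ} (hφ : ∀ x, (1 + |x|) ^ 2 * ‖φ x‖ ≤ D) (j : ℤ)
    (u : ℝ) : ‖dilate φ j u‖ₑ ≤ ∑' l : ℕ, {v : ℝ | |v| ≤ 2 ^ l * (2 : ℝ) ^ (-j)}.indicator
      (fun _ => ENNReal.ofReal (4 * D * (1 / 4) ^ l * 2 ^ j)) u := by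
  have hj : (0 : ℝ) < 2 ^ j := by positivity
  set v : ℝ := 2 ^ j * u with hv
  obtain ⟨l, hl1, hl2⟩ : ∃ l : ℕ, |v| ≤ 2 ^ l ∧ (4 : ℝ) ^ l ≤ 4 * (1 + |v|) ^ 2 := by
    have hex : ∃ l : ℕ, |v| ≤ 2 ^ l := (pow_unbounded_of_one_lt |v| one_lt_two).imp fun _ => le_of_lt
    classical
    refine ⟨Nat.find hex, Nat.find_spec hex, ?_⟩
    rcases Nat.eq_zero_or_pos (Nat.find hex) with h0 | h0
    · rw [h0]
      nlinarith [abs_nonneg v]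
    · have h1 := Nat.find_min hex (Nat.sub_one_lt_of_lt h0)
      obtain ⟨m, hm⟩ := Nat.exists_eq_succ_of_ne_zero h0.ne'
      rw [hm] at h1 ⊢
      simp only [Nat.succ_eq_add_one, Nat.add_sub_cancel, not_le] at h1
      have h4 : (4 : ℝ) ^ (m + 1) = 4 * (2 ^ m) ^ 2 := by
        rw [← pow_mul, mul_comm m 2, pow_mul, pow_succ]; norm_num; ring
      have : (0 : ℝ) < 2 ^ m := by positivity
      rw [Nat.succ_eq_add_one, h4]
      nlinarith [abs_nonneg v]
  have hmem : |u| ≤ 2 ^ l * (2 : ℝ) ^ (-j) := by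
    rw [zpow_neg, ← div_eq_mul_inv, le_div_iff₀ hj, mul_comm]
    rwa [hv, abs_mul, abs_of_pos hj] at hl1
  refine le_trans ?_ (ENNReal.le_tsum l)
  rw [Set.indicator_of_mem (show u ∈ {v : ℝ | |v| ≤ 2 ^ l * (2 : ℝ) ^ (-j)} from hmem),
    ← ofReal_norm]
  refine ENNReal.ofReal_le_ofReal ?_
  rw [dilate, norm_smul, Real.norm_of_nonneg hj.le, mul_comm, ← hv]
  refine mul_le_mul_of_nonneg_right ?_ hj.le
  rw [one_div, inv_pow, ← div_eq_mul_inv, le_div_iff₀ (by positivity)]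
  nlinarith [hφ v, norm_nonneg (φ v), mul_le_mul_of_nonneg_left hl2 (norm_nonneg (φ v))]

/-- A frequency localization is dominated by averages over concentric intervals. -/
lemma enorm_localize_le {φ : ℝ → ℂ} {D : ℝ} (hφ : ∀ x, (1 + |x|) ^ 2 * ‖φ x‖ ≤ D) (j : ℤ)
    (f : ℝ → ℂ) {h : ℝ → ℝ≥0∞} (hh : Measurable h) (hfh : (fun x => ‖f x‖ₑ) =ᵐ[volume] h)
    (z : ℝ) : ‖localize φ j f z‖ₑ ≤
      ENNReal.ofReal (16 * D) * ⨆ l : ℕ, ballAvg h (2 ^ l * (2 : ℝ) ^ (-j)) z := by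
  have hj : (0 : ℝ) < 2 ^ j := by positivity
  have hj' : (0 : ℝ) < 2 ^ (-j) := by positivity
  have hD : 0 ≤ D := le_trans (by positivity) (hφ 0)
  set κ : ℕ → ℝ≥0∞ := fun l => ENNReal.ofReal (4 * D * (1 / 4) ^ l * 2 ^ j) with hκ
  set U : ℕ → Set ℝ := fun l => {v : ℝ | |v| ≤ 2 ^ l * (2 : ℝ) ^ (-j)} with hU
  have hball : ∀ l, ∫⁻ w, (U l).indicator (fun _ => κ l) (z - w) * h w =
      κ l * ∫⁻ w in Metric.closedBall z (2 ^ l * (2 : ℝ) ^ (-j)), h w := by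
    intro l
    rw [← lintegral_indicator Metric.isClosed_closedBall.measurableSet,
      ← lintegral_const_mul _ (hh.indicator Metric.isClosed_closedBall.measurableSet)]
    refine lintegral_congr fun w => ?_
    have hiff : z - w ∈ U l ↔ w ∈ Metric.closedBall z (2 ^ l * (2 : ℝ) ^ (-j)) := by
      rw [Metric.mem_closedBall, dist_comm, Real.dist_eq]
      rfl
    by_cases hw : z - w ∈ U l
    · rw [Set.indicator_of_mem hw, Set.indicator_of_mem (hiff.1 hw)]
    · rw [Set.indicator_of_notMem hw, Set.indicator_of_notMem (fun h' => hw (hiff.2 h'))]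
      simp
  have hU_meas : ∀ l, MeasurableSet (U l) := fun l =>
    measurableSet_le measurable_abs measurable_const
  calc ‖localize φ j f z‖ₑ ≤ ∫⁻ t, ‖dilate φ j t‖ₑ * ‖f (z - t)‖ₑ := by
        refine (enorm_integral_le_lintegral_enorm _).trans (le_of_eq ?_)
        refine lintegral_congr fun t => ?_
        rw [ContinuousLinearMap.mul_apply', enorm_mul]
    _ = ∫⁻ w, ‖dilate φ j (z - w)‖ₑ * ‖f w‖ₑ := by
        rw [← lintegral_sub_left_eq_self _ z]
        simp
    _ = ∫⁻ w, ‖dilate φ j (z - w)‖ₑ * h w := by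
        refine lintegral_congr_ae ?_
        filter_upwards [hfh] with w hw
        rw [hw]
    _ ≤ ∫⁻ w, ∑' l, (U l).indicator (fun _ => κ l) (z - w) * h w := by
        refine lintegral_mono fun w => ?_
        simp only [ENNReal.tsum_mul_right]
        gcongr
        exact enorm_dilate_le_tsum hφ j (z - w)
    _ = ∑' l, κ l * ∫⁻ w in Metric.closedBall z (2 ^ l * (2 : ℝ) ^ (-j)), h w := by
        rw [lintegral_tsum]
        · exact tsum_congr hball
        · intro l
          exact (((measurable_const.indicator (hU_meas l)).comp
            (measurable_const.sub measurable_id)).mul hh).aemeasurable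
    -- The weights decay like `4^{-l}` while the interval lengths grow like `2^l`, leaving a
    -- geometric series.
    _ ≤ ∑' l : ℕ, ENNReal.ofReal (8 * D * (1 / 2) ^ l) *
          ⨆ l : ℕ, ballAvg h (2 ^ l * (2 : ℝ) ^ (-j)) z := by
        refine ENNReal.tsum_le_tsum fun l => ?_
        have hpos : (0 : ℝ) < 2 * (2 ^ l * (2 : ℝ) ^ (-j)) := by positivity
        have h1 : ∫⁻ w in Metric.closedBall z (2 ^ l * (2 : ℝ) ^ (-j)), h w =
            ENNReal.ofReal (2 * (2 ^ l * (2 : ℝ) ^ (-j))) *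
              ballAvg h (2 ^ l * (2 : ℝ) ^ (-j)) z := by
          rw [ballAvg, ENNReal.mul_div_cancel (by simpa using hpos) ENNReal.ofReal_ne_top]
        rw [h1, ← mul_assoc, hκ, ← ENNReal.ofReal_mul (by positivity)]
        have h2 : 4 * D * (1 / 4) ^ l * 2 ^ j * (2 * (2 ^ l * (2 : ℝ) ^ (-j))) =
            8 * D * (1 / 2) ^ l := by
          have h4 : (1 / 4 : ℝ) ^ l * 2 ^ l = (1 / 2) ^ l := by
            rw [← mul_pow]; norm_num
          have h5 : (2 : ℝ) ^ j * 2 ^ (-j) = 1 := by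
            rw [zpow_neg, mul_inv_cancel₀ hj.ne']
          linear_combination 8 * D * (2 ^ j * 2 ^ (-j)) * h4 + 8 * D * (1 / 2) ^ l * h5
        rw [h2]
        gcongr
        exact le_iSup (fun l : ℕ => ballAvg h (2 ^ l * (2 : ℝ) ^ (-j)) z) l
    _ = _ := by
        rw [ENNReal.tsum_mul_right, ← ENNReal.ofReal_tsum_of_nonneg (fun l => by positivity)
          (summable_geometric_two.mul_left _), tsum_mul_left, tsum_geometric_two]
        congr 2
        ring

lemma one_add_abs_sq_mul_norm_le {A : ℝ} {ψ : 𝓢(ℝ, ℂ)}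
    (hψ : ∀ j ≤ 2, SchwartzMap.seminorm ℝ j 0 ψ ≤ A) (x : ℝ) :
    (1 + |x|) ^ 2 * ‖ψ x‖ ≤ 4 * A := by
  have h0 := (SchwartzMap.norm_pow_mul_le_seminorm ℝ ψ 0 x).trans (hψ 0 (by norm_num))
  have h2 := (SchwartzMap.norm_pow_mul_le_seminorm ℝ ψ 2 x).trans (hψ 2 le_rfl)
  rw [pow_zero, one_mul] at h0
  rw [Real.norm_eq_abs] at h2
  -- This is `(1 + |x|)^2 ≤ 2 + 2|x|^2`.
  nlinarith [mul_nonneg (sq_nonneg (1 - |x|)) (norm_nonneg (ψ x))]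

/-! ### Jensen and Hölder -/

/-- Jensen's inequality followed by Tonelli: averaging over a probability space a family of
functions bounded in `L^p` preserves the bound. -/
lemma eLpNorm_lintegral_le {Ω : Type*} [MeasurableSpace Ω] {μ : Measure Ω} [IsProbabilityMeasure μ]
    {G : Ω → ℝ → ℝ≥0∞} (hG : Measurable (Function.uncurry G)) {p : ℝ≥0∞} (hp : 1 ≤ p)
    (hpt : p ≠ ∞) {M : ℝ≥0∞} (hM : ∀ᵐ t ∂μ, eLpNorm (G t) p volume ≤ M) :
    eLpNorm (fun x => ∫⁻ t, G t x ∂μ) p volume ≤ M := by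
  have hp1 : 1 ≤ p.toReal := by
    rw [← ENNReal.toReal_one]
    exact ENNReal.toReal_mono hpt hp
  have hp0 : 0 < p.toReal := by linarith
  have hpne : p ≠ 0 := (zero_lt_one.trans_le hp).ne'
  rw [eLpNorm_eq_lintegral_rpow_enorm_toReal hpne hpt, one_div, ENNReal.rpow_inv_le_iff hp0]
  simp only [enorm_eq_self]
  have hGx : ∀ x, Measurable fun t => G t x := fun x => hG.comp (measurable_id.prodMk measurable_const)
  calc ∫⁻ x, (∫⁻ t, G t x ∂μ) ^ p.toReal ≤ ∫⁻ x, ∫⁻ t, G t x ^ p.toReal ∂μ := by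
        refine lintegral_mono fun x => ?_
        have h1 := eLpNorm'_le_eLpNorm'_of_exponent_le (f := fun t => G t x) zero_lt_one hp1 μ
          (hGx x).aestronglyMeasurable
        simp only [eLpNorm', enorm_eq_self, ENNReal.rpow_one, one_div, inv_one] at h1
        rwa [ENNReal.le_rpow_inv_iff hp0] at h1
    _ = ∫⁻ t, (∫⁻ x, G t x ^ p.toReal) ∂μ := by
        refine lintegral_lintegral_swap ?_
        exact ((hG.comp measurable_swap).pow_const _).aemeasurable
    _ ≤ ∫⁻ _, M ^ p.toReal ∂μ := by
        refine lintegral_mono_ae (hM.mono fun t ht => ?_)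
        rw [eLpNorm_eq_lintegral_rpow_enorm_toReal hpne hpt, one_div,
          ENNReal.rpow_inv_le_iff hp0] at ht
        simpa only [enorm_eq_self] using ht
    _ = M ^ p.toReal := by simp

/-- Hölder's inequality for a finite product of `ℝ≥0∞`-valued functions. -/
lemma eLpNorm_prod_le_prod_eLpNorm {ι : Type*} [Fintype ι] {p : ℝ≥0∞} {q : ι → ℝ≥0∞}
    (hpq : p⁻¹ = ∑ i, (q i)⁻¹) (hp0 : p ≠ 0) (hpt : p ≠ ∞) {g : ι → ℝ → ℝ≥0∞}
    (hg : ∀ i, Measurable (g i)) :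
    eLpNorm (fun x => ∏ i, g i x) p volume ≤ ∏ i, eLpNorm (g i) (q i) volume := by
  classical
  have hpr : 0 < p.toReal := ENNReal.toReal_pos hp0 hpt
  have hq0 : ∀ i, q i ≠ 0 := by
    intro i hi
    have h1 : (q i)⁻¹ ≤ p⁻¹ := hpq ▸ Finset.single_le_sum (f := fun i => (q i)⁻¹)
      (fun _ _ => zero_le) (Finset.mem_univ i)
    rw [hi, ENNReal.inv_zero, top_le_iff, ENNReal.inv_eq_top] at h1
    exact hp0 h1
  -- Infinite exponents are split off and bounded by essential suprema; over the finite ones the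
  -- weights `p / q i` sum to 1.
  set F : Finset ι := Finset.univ.filter fun i => q i ≠ ∞ with hF
  set E : Finset ι := Finset.univ.filter fun i => ¬ q i ≠ ∞ with hE
  have hsplit : ∀ u : ι → ℝ≥0∞, ∏ i, u i = (∏ i ∈ F, u i) * ∏ i ∈ E, u i := fun u =>
    (Finset.prod_filter_mul_prod_filter_not Finset.univ (fun i => q i ≠ ∞) u).symm
  have hFq : ∀ i ∈ F, 0 < (q i).toReal := fun i hi =>
    ENNReal.toReal_pos (hq0 i) (Finset.mem_filter.1 hi).2
  have hw : ∑ i ∈ F, p.toReal / (q i).toReal = 1 := by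
    have h1 : p⁻¹ = ∑ i ∈ F, (q i)⁻¹ := by
      rw [hpq, ← Finset.sum_filter_add_sum_filter_not Finset.univ (fun i => q i ≠ ∞)]
      have : ∑ i ∈ Finset.univ.filter (fun i => ¬ q i ≠ ∞), (q i)⁻¹ = 0 :=
        Finset.sum_eq_zero fun i hi => by simpa using (Finset.mem_filter.1 hi).2
      rw [this, add_zero]
    have h2 := congrArg ENNReal.toReal h1
    rw [ENNReal.toReal_sum (fun i _ => ENNReal.inv_ne_top.2 (hq0 i)), ENNReal.toReal_inv] at h2
    simp only [ENNReal.toReal_inv] at h2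
    simp only [div_eq_mul_inv]
    rw [← Finset.mul_sum, ← h2, mul_inv_cancel₀ hpr.ne']
  set M : ℝ≥0∞ := ∏ i ∈ E, eLpNorm (g i) (q i) volume with hM
  have hEbd : ∀ᵐ x, ∏ i ∈ E, g i x ≤ M := by
    have : ∀ᵐ x, ∀ i ∈ E, g i x ≤ eLpNorm (g i) (q i) volume := by
      refine (Finset.eventually_all E).2 fun i hi => ?_
      have hqi : q i = ∞ := by simpa using (Finset.mem_filter.1 hi).2
      rw [hqi, eLpNorm_exponent_top]
      exact enorm_ae_le_eLpNormEssSup (g i) volume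
    filter_upwards [this] with x hx
    exact Finset.prod_le_prod' hx
  rw [eLpNorm_eq_lintegral_rpow_enorm_toReal hp0 hpt, one_div, ENNReal.rpow_inv_le_iff hpr]
  simp only [enorm_eq_self]
  calc ∫⁻ x, (∏ i, g i x) ^ p.toReal
      ≤ ∫⁻ x, M ^ p.toReal * ∏ i ∈ F, (g i x ^ (q i).toReal) ^ (p.toReal / (q i).toReal) := by
        refine lintegral_mono_ae ?_
        filter_upwards [hEbd] with x hx
        rw [hsplit, mul_comm, ENNReal.mul_rpow_of_nonneg _ _ hpr.le,
          ← ENNReal.prod_rpow_of_nonneg (s := F) hpr.le]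
        have : ∀ i ∈ F, (g i x ^ (q i).toReal) ^ (p.toReal / (q i).toReal) =
            g i x ^ p.toReal := fun i hi => by
          rw [← ENNReal.rpow_mul, mul_div_cancel₀ _ (hFq i hi).ne']
        rw [Finset.prod_congr rfl this]
        gcongr
    _ = M ^ p.toReal *
        ∫⁻ x, ∏ i ∈ F, (g i x ^ (q i).toReal) ^ (p.toReal / (q i).toReal) := by
        refine lintegral_const_mul _ (Finset.measurable_fun_prod _ fun i _ => ?_)
        exact ((hg i).pow_const _).pow_const _
    _ ≤ M ^ p.toReal *
        ∏ i ∈ F, (∫⁻ x, g i x ^ (q i).toReal) ^ (p.toReal / (q i).toReal) :=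
        mul_le_mul_right (ENNReal.lintegral_prod_norm_pow_le F
          (fun i _ => ((hg i).pow_const _).aemeasurable) hw fun i hi => by
            have := hFq i hi
            positivity) _
    _ = (∏ i, eLpNorm (g i) (q i) volume) ^ p.toReal := by
        rw [hsplit, mul_comm (∏ i ∈ F, _), ENNReal.mul_rpow_of_nonneg _ _ hpr.le,
          ← ENNReal.prod_rpow_of_nonneg (s := F) hpr.le]
        congr 1
        refine Finset.prod_congr rfl fun i hi => ?_
        rw [eLpNorm_eq_lintegral_rpow_enorm_toReal (hq0 i) (Finset.mem_filter.1 hi).2,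
          ← ENNReal.rpow_mul]
        simp only [enorm_eq_self]
        congr 1
        ring

/-! ### Maximal functions along the curve -/

variable {n : ℕ}

/-- The shifted maximal functions of the inputs along the curve at time `t`, multiplied. -/
def prodShiftedSup (a : Fin n → ℝ) (d : Fin n → ℕ) (s : Fin n → ℤ) (h : Fin n → ℝ → ℝ≥0∞)
    (t x : ℝ) : ℝ≥0∞ :=
  ∏ i, shiftedSup (fun k => curve a d i ((2 : ℝ) ^ (-k) * t))
    (fun k => (2 : ℝ) ^ (-(k * (d i : ℤ) + s i))) (h i) x

lemma measurable_uncurry_prodShiftedSup (a : Fin n → ℝ) (d : Fin n → ℕ) (s : Fin n → ℤ)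
    {h : Fin n → ℝ → ℝ≥0∞} (hh : ∀ i, Measurable (h i)) :
    Measurable (Function.uncurry (prodShiftedSup a d s h)) := by
  unfold prodShiftedSup shiftedSup Function.uncurry
  refine Finset.measurable_fun_prod _ fun i _ => ?_
  refine Measurable.iSup fun k => Measurable.iSup fun l => ?_
  have : Measurable fun z : ℝ × ℝ => z.2 - curve a d i ((2 : ℝ) ^ (-k) * z.1) := by
    unfold curve
    fun_prop
  exact (measurable_ballAvg (hh i) _).comp this

lemma iSup_ballAvg_le_shiftedSup (b r : ℤ → ℝ) (h : ℝ → ℝ≥0∞) (x : ℝ) (k : ℤ) :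
    ⨆ l : ℕ, ballAvg h (2 ^ l * r k) (x - b k) ≤ shiftedSup b r h x :=
  le_iSup (fun k => ⨆ l : ℕ, ballAvg h (2 ^ l * r k) (x - b k)) k

lemma shiftedMax_le_lintegral (a : Fin n → ℝ) (d : Fin n → ℕ) (s : Fin n → ℤ) {φ : ℝ → ℂ} {D : ℝ}
    (hφ : ∀ x, (1 + |x|) ^ 2 * ‖φ x‖ ≤ D) (f : Fin n → ℝ → ℂ) {h : Fin n → ℝ → ℝ≥0∞}
    (hh : ∀ i, Measurable (h i)) (hfh : ∀ i, (fun x => ‖f i x‖ₑ) =ᵐ[volume] h i) (x : ℝ) :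
    shiftedMax a d φ s f x ≤ ENNReal.ofReal (16 * D) ^ n *
      ∫⁻ t in Set.Ioc (0 : ℝ) 1, prodShiftedSup a d s h t x := by
  refine iSup_le fun k => ?_
  rw [multiAvg, intervalIntegral.integral_of_le zero_le_one]
  refine (enorm_integral_le_lintegral_enorm _).trans ?_
  have hm : Measurable fun t => prodShiftedSup a d s h t x :=
    (measurable_uncurry_prodShiftedSup a d s hh).of_uncurry_right
  rw [← lintegral_const_mul _ hm]
  refine lintegral_mono fun t => ?_
  have hc : ENNReal.ofReal (16 * D) ^ n = ∏ _i : Fin n, ENNReal.ofReal (16 * D) := by simp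
  rw [prodShiftedSup, hc, ← Finset.prod_mul_distrib, enorm_eq_nnnorm, nnnorm_prod,
    ENNReal.ofNNReal_finsetProd]
  refine Finset.prod_le_prod' fun i _ => ?_
  refine (enorm_localize_le hφ _ (f i) (hh i) (hfh i) _).trans (mul_le_mul_right ?_ _)
  exact iSup_ballAvg_le_shiftedSup (fun k => curve a d i ((2 : ℝ) ^ (-k) * t))
    (fun k => (2 : ℝ) ^ (-(k * (d i : ℤ) + s i))) (h i) x k

/-- The only place where the size of `s i` enters: `2^{-k d_i}` is `2^{s_i}` times the radius, so
the shift-to-radius ratio is at most `2^{e+m}`. -/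
lemma abs_curve_le {a : Fin n → ℝ} (d : Fin n → ℕ) {s : Fin n → ℤ} {i : Fin n} {e m : ℕ}
    (ha : |a i| ≤ 2 ^ e) (hs : s i ≤ m) {t : ℝ} (ht : t ∈ Set.Ioc (0 : ℝ) 1) (k : ℤ) :
    |curve a d i ((2 : ℝ) ^ (-k) * t)| ≤ 2 ^ (e + m) * (2 : ℝ) ^ (-(k * (d i : ℤ) + s i)) := by
  have h1 : (2 : ℝ) ^ (-(k * (d i : ℤ))) ≤ 2 ^ m * (2 : ℝ) ^ (-(k * (d i : ℤ) + s i)) := by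
    rw [← zpow_natCast (2 : ℝ) m, ← zpow_add₀ two_ne_zero]
    exact zpow_le_zpow_right₀ one_le_two (by omega)
  have h2 : ((2 : ℝ) ^ (-k) * t) ^ d i ≤ (2 : ℝ) ^ (-(k * (d i : ℤ))) := by
    rw [← neg_mul, zpow_mul, zpow_natCast]
    have := ht.1
    exact pow_le_pow_left₀ (by positivity) (mul_le_of_le_one_right (by positivity) ht.2) _
  have h3 : 0 ≤ ((2 : ℝ) ^ (-k) * t) ^ d i := by have := ht.1; positivity
  rw [curve, abs_mul, abs_of_nonneg h3, pow_add, mul_assoc]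
  exact mul_le_mul ha (h2.trans h1) h3 (by positivity)

end

end HomCurve

/-! ### Assembly -/

open HomCurve in
theorem proposition2p3 (n : ℕ) (hn : 2 ≤ n)
    (a : Fin n → ℝ) (ha : ∀ i, a i ≠ 0)
    (d : Fin n → ℕ) (hd_pos : ∀ i, 1 ≤ d i) (hd : StrictMono d)
    (p : ℝ≥0∞) (q : Fin n → ℝ≥0∞) (hq : ∀ i, 1 < q i)
    (hpq : p⁻¹ = ∑ i, (q i)⁻¹) (hp : p⁻¹ ≤ 1) :
    ∃ N : ℕ, ∀ A : ℝ, ∃ C : ℝ≥0,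
      ∀ ψ : 𝓢(ℝ, ℂ), (∀ j ≤ N, ∀ l ≤ N, SchwartzMap.seminorm ℝ j l ψ ≤ A) →
      ∀ (s : Fin n → ℤ) (S : ℤ), IsGreatest (Set.range s) S →
      ∀ f : Fin n → ℝ → ℂ, (∀ i, MemLp (f i) (q i) volume) →
        eLpNorm (HomCurve.shiftedMax a d ψ s f) p volume
          ≤ (C : ℝ≥0∞) * ENNReal.ofReal ((max 1 (S : ℝ)) ^ n)
              * ∏ i, eLpNorm (f i) (q i) volume := by
  choose C hC1 hC using fun i => exists_eLpNorm_shiftedSup_le (hq i)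
  obtain ⟨e, he⟩ : ∃ e : ℕ, ∀ i, |a i| ≤ 2 ^ e := by
    obtain ⟨B, hB⟩ := (Set.finite_range fun i => |a i|).bddAbove
    obtain ⟨e, he⟩ := pow_unbounded_of_one_lt B (one_lt_two : (1 : ℝ) < 2)
    exact ⟨e, fun i => (hB ⟨i, rfl⟩).trans he.le⟩
  -- Only quadratic decay of `ψ` is used, hence `N = 2`. With `e + m + 4` long shifts the maximal
  -- bound carries `6 + 5(e + m + 4)`, which is at most `(31 + 5e) m` because `m = max 1 S ≥ 1`.
  refine ⟨2, fun A => ⟨Real.toNNReal (16 * (4 * A)) ^ n * ∏ i, (C i * (31 + 5 * e : ℕ)), ?_⟩⟩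
  intro ψ hψ s S hS f hf
  have hφ := one_add_abs_sq_mul_norm_le (ψ := ψ) fun j hj => hψ j hj 0 (Nat.zero_le _)
  obtain ⟨m, hm⟩ : ∃ m : ℕ, (m : ℤ) = max 1 S := ⟨(max 1 S).toNat, by omega⟩
  have hm1 : 1 ≤ m := by omega
  have hsm : ∀ i, s i ≤ m := fun i => by have := hS.2 ⟨i, rfl⟩; omega
  have hmR : ENNReal.ofReal ((max 1 (S : ℝ)) ^ n) = ∏ _i : Fin n, (m : ℝ≥0∞) := by
    have : max 1 (S : ℝ) = (m : ℝ) := by exact_mod_cast hm.symm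
    rw [this, ENNReal.ofReal_pow (by positivity), ENNReal.ofReal_natCast]
    simp
  have hp1 : 1 ≤ p := ENNReal.inv_le_one.1 hp
  -- A measurable representative; averages do not see the null set where it differs from `f i`.
  set h : Fin n → ℝ → ℝ≥0∞ := fun i x => ‖(hf i).1.mk (f i) x‖ₑ
  have hh : ∀ i, Measurable (h i) := fun i => (hf i).1.stronglyMeasurable_mk.measurable.enorm
  have hfh : ∀ i, (fun x => ‖f i x‖ₑ) =ᵐ[volume] h i := fun i =>
    (hf i).1.ae_eq_mk.fun_comp (fun z => ‖z‖ₑ)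
  have hnorm : ∀ i, eLpNorm (h i) (q i) volume = eLpNorm (f i) (q i) volume := fun i =>
    eLpNorm_congr_enorm_ae ((hfh i).symm.trans (by simp))
  set W : ℝ≥0∞ := ((31 + 5 * e : ℕ) : ℝ≥0∞) with hW
  have hsup : ∀ t ∈ Set.Ioc (0 : ℝ) 1, ∀ i,
      eLpNorm (shiftedSup (fun k => curve a d i ((2 : ℝ) ^ (-k) * t))
        (fun k => (2 : ℝ) ^ (-(k * (d i : ℤ) + s i))) (h i)) (q i) volume ≤
      C i * W * m * eLpNorm (f i) (q i) volume := by
    intro t ht i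
    have hcount := shiftCountLE_of_dyadic (hd_pos i) (s i) (e + m)
      (abs_curve_le d (he i) (hsm i) ht)
    refine (hC i _ _ _ (fun k => by positivity) hcount (h i) (hh i)).trans ?_
    rw [hnorm i, mul_assoc (C i : ℝ≥0∞)]
    rw [mul_assoc (C i : ℝ≥0∞), mul_assoc (C i : ℝ≥0∞), hW]
    refine mul_le_mul_right (mul_le_mul_left ?_ _) _
    have : 6 + 5 * (e + m + 4) ≤ (31 + 5 * e) * m := by nlinarith
    exact_mod_cast this
  have hmain : eLpNorm (fun x => ∫⁻ t in Set.Ioc (0 : ℝ) 1, prodShiftedSup a d s h t x) p volume ≤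
      ∏ i, (C i * W * m * eLpNorm (f i) (q i) volume) := by
    have : IsProbabilityMeasure (volume.restrict (Set.Ioc (0 : ℝ) 1)) := ⟨by simp⟩
    rcases eq_or_ne p ∞ with rfl | hpt
    -- For `p = ∞` every exponent is infinite, and the trivial bound of averages by the essential
    -- supremum suffices.
    · have hqt : ∀ i, q i = ∞ := by
        rw [ENNReal.inv_top, eq_comm, Finset.sum_eq_zero_iff] at hpq
        exact fun i => ENNReal.inv_eq_zero.1 (hpq i (Finset.mem_univ i))
      rw [eLpNorm_exponent_top]
      refine eLpNormEssSup_le_of_ae_enorm_bound (Filter.Eventually.of_forall fun x => ?_)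
      rw [enorm_eq_self]
      have hle : ∀ t, prodShiftedSup a d s h t x ≤
          ∏ i, (C i * W * m * eLpNorm (f i) (q i) volume) := by
        refine fun t => Finset.prod_le_prod' fun i _ => ?_
        refine (shiftedSup_le_of_ae_le (enorm_ae_le_eLpNormEssSup (h i) volume) _ _ x).trans ?_
        rw [← eLpNorm_exponent_top, ← hqt i, hnorm i]
        have h1 : (1 : ℝ≥0∞) ≤ C i := by exact_mod_cast hC1 i
        have h2 : 1 ≤ W := by rw [hW]; exact_mod_cast (by omega : 1 ≤ 31 + 5 * e)
        have h3 : (1 : ℝ≥0∞) ≤ m := by exact_mod_cast hm1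
        exact le_mul_of_one_le_left zero_le (one_le_mul (one_le_mul h1 h2) h3)
      exact (lintegral_mono hle).trans (by simp)
    · refine eLpNorm_lintegral_le (measurable_uncurry_prodShiftedSup a d s hh) hp1 hpt ?_
      refine (ae_restrict_iff' measurableSet_Ioc).2 (Filter.Eventually.of_forall fun t ht => ?_)
      refine (eLpNorm_prod_le_prod_eLpNorm hpq (zero_lt_one.trans_le hp1).ne' hpt
        fun i => measurable_shiftedSup (hh i) _ _).trans ?_
      exact Finset.prod_le_prod' fun i _ => hsup t ht i
  refine (eLpNorm_le_nnreal_smul_eLpNorm_of_ae_le_mul' (c := Real.toNNReal (16 * (4 * A)) ^ n)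
    (g := fun x => ∫⁻ t in Set.Ioc (0 : ℝ) 1, prodShiftedSup a d s h t x)
    (Filter.Eventually.of_forall fun x => ?_) p).trans ?_
  · have := shiftedMax_le_lintegral a d s hφ f hh hfh x
    simpa [ENNReal.ofReal] using this
  · rw [ENNReal.smul_def, smul_eq_mul]
    refine (mul_le_mul_right hmain _).trans (le_of_eq ?_)
    rw [hmR]
    simp only [Finset.prod_mul_distrib]
    push_cast
    simp only [hW]
    push_cast
    ring
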